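/- **Lemma (concentration of the normalized adjacency matrix).** Consider a stochastic block model on $n$ nodes with $k$ nonempty groups, given by group labels $g_1,\dots,g_n\in\{1,\dots,k\}$ and a symmetric affinity matrix $\Omega\in[0,1]^{k\times k}$. Let $G\in\{0,1\}^{n\times k}$ be the partition indicator matrix ($G_{ia}=1$ if and only if $g_i=a$). The model generates a random symmetric adjacency matrix $A\in\{0,1\}^{n\times n}$ whose entries $A_{ij}$, $i\le j$ (self-loops allowed), are mutually independent with $A_{ij}\sim\mathrm{Ber}(\Omega_{g_i g_j})$. Write $\mathcal A:=\mathbb E[A]=G\Omega G^\top$, let $\delta_i:=[\mathcal A\mathbf 1]_i$ be the expected degrees and $\delta_{\min}:=\min_i\delta_i$. Put $D:=\mathrm{diag}(A\mathbf 1)$, $L:=D^{-1/2}AD^{-1/2}$ and $$\mathcal L:=\mathbb E[D]^{-1/2}\,\mathbb E[A]\,\mathbb E[D]^{-1/2}=\mathrm{diag}(\mathcal A\mathbf 1)^{-1/2}\,\mathcal A\,\mathrm{diag}(\mathcal A\mathbf 1)^{-1/2}.$$ Let $\epsilon>0$ (for $\epsilon\ge 1$ the claim is trivial) and suppose that $$\delta_{\min}>27\ln\left(\frac{4n}{\epsilon}\right).$$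 Then, with probability at least $1-\epsilon$, all degrees $D_{ii}$ are positive (so that $L$ is well defined) and, in the spectral norm, $$\|L-\mathcal L\|\le 3\sqrt{\frac{3\ln(4n/\epsilon)}{\delta_{\min}}}.$$ -/

import Mathlib

open MeasureTheory ProbabilityTheory Matrix

noncomputable section

namespace SBM

/-- The degree of node `i` in a (weighted) adjacency matrix `B`, that is, `[B 1]_i`.
A self-loop contributes once. -/
def degree {n : ℕ} (B : Matrix (Fin n) (Fin n) ℝ) (i : Fin n) : ℝ :=
  (B *ᵥ 1) i

/-- The matrix `D^{-1/2}`, where `D = diag(B 1)` is the diagonal degree matrix of `B`.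
(An entry with degree zero becomes zero.) -/
def invSqrtDegree {n : ℕ} (B : Matrix (Fin n) (Fin n) ℝ) : Matrix (Fin n) (Fin n) ℝ :=
  Matrix.diagonal fun i => (degree B i) ^ (-(1 / 2 : ℝ))

/-- The normalized (weighted) adjacency matrix `D^{-1/2} B D^{-1/2}`. -/
def normalized {n : ℕ} (B : Matrix (Fin n) (Fin n) ℝ) : Matrix (Fin n) (Fin n) ℝ :=
  invSqrtDegree B * B * invSqrtDegree B

/-- The spectral norm of a real square matrix: the operator norm with respect to the
Euclidean norm. -/
def spectralNorm {n : ℕ} (B : Matrix (Fin n) (Fin n) ℝ) : ℝ :=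
  ‖Matrix.toEuclideanCLM (n := Fin n) (𝕜 := ℝ) B‖

/-- The parameters of a stochastic block model with `n` nodes and `k` nonempty groups. -/
structure Model (n k : ℕ) where
  /-- the group label of each node -/
  label : Fin n → Fin k
  /-- every group is nonempty -/
  label_surjective : Function.Surjective label
  /-- the matrix of link probabilities between the groups -/
  affinity : Matrix (Fin k) (Fin k) ℝ
  affinity_symm : affinity.IsSymm
  affinity_nonneg : ∀ a b, 0 ≤ affinity a b
  affinity_le_one : ∀ a b, affinity a b ≤ 1

namespace Model

variable {n k : ℕ} (M : Model n k)

/-- The partition indicator matrix `G`. -/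
def indicator : Matrix (Fin n) (Fin k) ℝ :=
  Matrix.of fun i a => if M.label i = a then 1 else 0

/-- The expected adjacency matrix `G Ω Gᵀ`. -/
def expectedAdjacency : Matrix (Fin n) (Fin n) ℝ :=
  M.indicator * M.affinity * M.indicatorᵀ

theorem expectedAdjacency_apply (i j : Fin n) :
    M.expectedAdjacency i j = M.affinity (M.label i) (M.label j) := by
  simp [expectedAdjacency, indicator, Matrix.mul_apply]

/-- The smallest expected degree. -/
def minExpectedDegree : ℝ :=
  ⨅ i : Fin n, degree M.expectedAdjacency i

/-- Membership in the class of models with a sufficiently large smallest expected degree. -/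
def HasConcentration (ε : ℝ) : Prop :=
  27 * Real.log (4 * (n : ℝ) / ε) < M.minExpectedDegree

/-- The random matrix `A` on the probability space `(S, P)` is the adjacency matrix of an
undirected network (self-loops allowed) generated by the model `M`: it is symmetric with entries
in `{0, 1}`, its entries on and above the diagonal are mutually independent, and each entry is a
Bernoulli variable whose parameter is the affinity of the groups of the two nodes. -/
structure Generates {S : Type*} [MeasurableSpace S] (P : Measure S)
    (A : S → Matrix (Fin n) (Fin n) ℝ) : Prop where
  measurable_entry : ∀ i j, Measurable fun s => A s i j
  zero_or_one : ∀ s i j, A s i j = 0 ∨ A s i j = 1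
  symm : ∀ s, (A s).IsSymm
  prob_link : ∀ i j, P.real {s | A s i j = 1} = M.affinity (M.label i) (M.label j)
  indep : iIndepFun (fun (e : {e : Fin n × Fin n // e.1 ≤ e.2}) (s : S) => A s e.1.1 e.1.2) P

/-- The matrix `expectedAdjacency` is the entrywise expectation of the random adjacency matrix. -/
theorem Generates.integral_entry {M : Model n k} {S : Type*} [MeasurableSpace S] {P : Measure S}
    {A : S → Matrix (Fin n) (Fin n) ℝ} (hA : M.Generates P A) (i j : Fin n) :
    ∫ s, A s i j ∂P = M.expectedAdjacency i j := by
  have h : (fun s => A s i j) = Set.indicator {s | A s i j = 1} 1 := by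
    funext s
    rcases hA.zero_or_one s i j with h | h <;> simp [Set.indicator, h]
  have hm : MeasurableSet {s | A s i j = 1} :=
    hA.measurable_entry i j (measurableSet_singleton 1)
  rw [h, integral_indicator_one hm, hA.prob_link, expectedAdjacency_apply]

end Model

end SBM

end

/-! Write `C` for the expected adjacency matrix and `T` for its diagonal degree matrix. Then `L - ℒ`
splits as `(L - T^{-1/2} A T^{-1/2}) + T^{-1/2} (A - C) T^{-1/2}`.

The second term is a sum of independent centered symmetric matrices, one per unordered pair of
nodes, each of norm at most `1/δ_min` and with total variance at most `1/δ_min`. A matrix Bernstein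
bound (`measureReal_exists_quadraticForm_gt_le`) controls its quadratic form from both sides. The
relative deviations of the degrees are the diagonal entries of a diagonal sum of the same kind, so
the same bound controls them. The first term is then small deterministically
(`norm_normalized_sub_le`): rescaling by nearly equal degrees hardly moves `L`, because `‖L‖ ≤ 1`.

The Bernstein bound is the matrix Laplace transform method. Each summand is compensated by its
second-order term so that its exponential has expectation at most the identity, and the
Golden-Thompson inequality removes the summands one at a time from the expected trace exponential.
-/

/-! ### Trace inequalities for powers of products of symmetric matrices. -/

section GoldenThompson

variable {ι : Type*} [Fintype ι] [DecidableEq ι]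

theorem Matrix.trace_mul_pow_comm (X Y : Matrix ι ι ℝ) (m : ℕ) :
    trace ((X * Y) ^ m) = trace ((Y * X) ^ m) := by
  cases m with
  | zero => simp
  | succ m =>
    have h : SemiconjBy X (Y * X) (X * Y) := by simp [SemiconjBy, mul_assoc]
    have h' := (h.pow_right m).eq
    rw [pow_succ, ← mul_assoc, ← h', mul_assoc, trace_mul_comm, mul_assoc, ← pow_succ]

omit [DecidableEq ι] in
theorem Matrix.trace_mul_transpose_self_nonneg (N : Matrix ι ι ℝ) : 0 ≤ trace (N * Nᵀ) := by
  simp only [trace, diag_apply, mul_apply, transpose_apply]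
  exact Finset.sum_nonneg fun i _ => Finset.sum_nonneg fun j _ => mul_self_nonneg _

omit [DecidableEq ι] in
theorem Matrix.trace_mul_self_le (N : Matrix ι ι ℝ) : trace (N * N) ≤ trace (N * Nᵀ) := by
  have h := trace_mul_transpose_self_nonneg (N - Nᵀ)
  have h1 : trace (Nᵀ * Nᵀ) = trace (N * N) := by rw [← transpose_mul, trace_transpose]
  have h2 : trace (Nᵀ * N) = trace (N * Nᵀ) := trace_mul_comm _ _
  simp only [transpose_sub, transpose_transpose, sub_mul, mul_sub, trace_sub, h1, h2] at h
  linarith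

omit [DecidableEq ι] in
theorem Matrix.trace_mul_le_of_isSymm {P Q : Matrix ι ι ℝ} (hP : P.IsSymm) (hQ : Q.IsSymm) :
    trace (P * Q) ≤ (trace (P * P) + trace (Q * Q)) / 2 := by
  have h := trace_mul_transpose_self_nonneg (P - Q)
  have h2 : trace (Q * P) = trace (P * Q) := trace_mul_comm _ _
  simp only [transpose_sub, hP.eq, hQ.eq, sub_mul, mul_sub, trace_sub, h2] at h
  linarith

/-- The two claims feed each other. For the first, apply it to `M * M`, rotate the trace cyclically,
use the second on `Mᵀ * M` and `M * Mᵀ`, and finish with Cauchy-Schwarz, since powers of these two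
have equal trace. For the second, apply the first to `P * Q`, rotate, and use the second on the
squares. -/
theorem Matrix.trace_pow_two_pow_le_and (k : ℕ) :
    (∀ M : Matrix ι ι ℝ, trace (M ^ 2 ^ (k + 1)) ≤ trace ((M * Mᵀ) ^ 2 ^ k)) ∧
    ∀ P Q : Matrix ι ι ℝ, P.IsSymm → Q.IsSymm →
      trace ((P * Q) ^ 2 ^ k) ≤ trace (P ^ 2 ^ k * Q ^ 2 ^ k) := by
  induction k with
  | zero => exact ⟨fun M => by simpa [pow_two] using trace_mul_self_le M, by simp⟩
  | succ k ih =>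
    obtain ⟨ha, hb⟩ := ih
    refine ⟨fun M => ?_, fun P Q hP hQ => ?_⟩
    · have hP : (Mᵀ * M).IsSymm := by simp [IsSymm]
      have hQ : (M * Mᵀ).IsSymm := by simp [IsSymm]
      have e1 : M ^ 2 ^ (k + 1 + 1) = (M * M) ^ 2 ^ (k + 1) := by
        rw [← pow_two, ← pow_mul, ← pow_succ']
      have e2 : trace ((M * M * (M * M)ᵀ) ^ 2 ^ k) = trace ((Mᵀ * M * (M * Mᵀ)) ^ 2 ^ k) := by
        rw [transpose_mul, ← mul_assoc, trace_mul_pow_comm]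
        simp only [mul_assoc]
      have e3 : trace ((Mᵀ * M) ^ 2 ^ (k + 1)) = trace ((M * Mᵀ) ^ 2 ^ (k + 1)) :=
        trace_mul_pow_comm _ _ _
      have e4 : ∀ R : Matrix ι ι ℝ, R ^ 2 ^ k * R ^ 2 ^ k = R ^ 2 ^ (k + 1) := fun R => by
        rw [← pow_add, pow_succ, mul_two]
      calc trace (M ^ 2 ^ (k + 1 + 1)) ≤ trace ((M * M * (M * M)ᵀ) ^ 2 ^ k) := by
            rw [e1]; exact ha _
        _ ≤ trace ((Mᵀ * M) ^ 2 ^ k * (M * Mᵀ) ^ 2 ^ k) := by rw [e2]; exact hb _ _ hP hQ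
        _ ≤ _ := by
          have := trace_mul_le_of_isSymm (hP.pow (2 ^ k)) (hQ.pow (2 ^ k))
          rw [e4, e4, e3] at this
          linarith
    · have e1 : ∀ R : Matrix ι ι ℝ, (R * R) ^ 2 ^ k = R ^ 2 ^ (k + 1) := fun R => by
        rw [← pow_two, ← pow_mul, ← pow_succ']
      calc trace ((P * Q) ^ 2 ^ (k + 1)) ≤ trace ((P * Q * (P * Q)ᵀ) ^ 2 ^ k) := ha _
        _ = trace ((P * P * (Q * Q)) ^ 2 ^ k) := by
          rw [transpose_mul, hP.eq, hQ.eq, ← mul_assoc, trace_mul_pow_comm]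
          simp only [mul_assoc]
        _ ≤ _ := by
          have hPP : (P * P).IsSymm := by simp [IsSymm, hP.eq]
          have hQQ : (Q * Q).IsSymm := by simp [IsSymm, hQ.eq]
          have := hb _ _ hPP hQQ
          rwa [e1 P, e1 Q] at this

end GoldenThompson

/-! ### The Lie-Trotter product formula and the Golden-Thompson inequality. -/

section LieTrotter

open NormedSpace Filter Topology

theorem norm_pow_sub_pow_le_of_norm_le {𝔸 : Type*} [NormedRing 𝔸] [NormOneClass 𝔸] {x y : 𝔸}
    {C : ℝ} (hC : 1 ≤ C) (hx : ‖x‖ ≤ C) (hy : ‖y‖ ≤ C) (m : ℕ) :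
    ‖x ^ m - y ^ m‖ ≤ m * ‖x - y‖ * C ^ m := by
  induction m with
  | zero => simp
  | succ m ih =>
    have e : x ^ (m + 1) - y ^ (m + 1) = x ^ m * (x - y) + (x ^ m - y ^ m) * y := by
      rw [pow_succ, pow_succ]; noncomm_ring
    have h1 : ‖x ^ m * (x - y)‖ ≤ C ^ (m + 1) * ‖x - y‖ := by
      refine (norm_mul_le _ _).trans ?_
      gcongr
      calc ‖x ^ m‖ ≤ ‖x‖ ^ m := norm_pow_le _ _
        _ ≤ C ^ m := by gcongr
        _ ≤ C ^ (m + 1) := pow_le_pow_right₀ hC (Nat.le_succ m)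
    have h2 : ‖(x ^ m - y ^ m) * y‖ ≤ (m * ‖x - y‖ * C ^ m) * C :=
      (norm_mul_le _ _).trans (by gcongr)
    rw [e]
    refine (norm_add_le _ _).trans ((add_le_add h1 h2).trans (le_of_eq ?_))
    push_cast
    ring

theorem NormedSpace.norm_exp_le_exp_norm {𝔸 : Type*} [NormedRing 𝔸] [NormOneClass 𝔸]
    [NormedAlgebra ℝ 𝔸] (x : 𝔸) : ‖exp x‖ ≤ Real.exp ‖x‖ := by
  rw [exp_eq_tsum ℝ]
  have h : HasSum (fun n : ℕ => (n.factorial : ℝ)⁻¹ • ‖x‖ ^ n) (Real.exp ‖x‖) := by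
    rw [Real.exp_eq_exp_ℝ]
    exact exp_series_hasSum_exp' _
  refine tsum_of_norm_bounded h fun n => ?_
  rw [norm_smul, smul_eq_mul, Real.norm_of_nonneg (by positivity)]
  gcongr
  exact norm_pow_le _ _

/-- The two factors agree to first order at `t = 0`, so for `t = 1/m` they differ by `o(1/m)`.
Telescoping the `m`-th powers costs a factor `m` times a bound independent of `m`. -/
theorem tendsto_exp_smul_mul_exp_smul_pow {𝔸 : Type*} [NormedRing 𝔸] [NormOneClass 𝔸]
    [NormedAlgebra ℝ 𝔸] [CompleteSpace 𝔸] (a b : 𝔸) :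
    Tendsto (fun m : ℕ => (exp ((m : ℝ)⁻¹ • a) * exp ((m : ℝ)⁻¹ • b)) ^ m) atTop
      (𝓝 (exp (a + b))) := by
  let _ : NormedAlgebra ℚ 𝔸 := NormedAlgebra.restrictScalars ℚ ℝ 𝔸
  set f : ℝ → 𝔸 := fun t => exp (t • a) * exp (t • b) - exp (t • (a + b)) with hf
  have hd : HasDerivAt f 0 0 := by
    have h := ((hasDerivAt_exp_smul_const (𝕂 := ℝ) a 0).mul
      (hasDerivAt_exp_smul_const (𝕂 := ℝ) b 0)).sub (hasDerivAt_exp_smul_const (𝕂 := ℝ) (a + b) 0)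
    convert! h using 1
    simp
  have hs := hasDerivAt_iff_tendsto_slope_zero.1 hd
  have hinv : Tendsto (fun m : ℕ => (m : ℝ)⁻¹) atTop (𝓝[≠] 0) := by
    refine tendsto_nhdsWithin_iff.2 ⟨tendsto_inv_atTop_nhds_zero_nat, ?_⟩
    filter_upwards [eventually_gt_atTop 0] with m hm
    simp [hm.ne']
  have h0 := (hs.comp hinv).norm.mul_const (Real.exp (‖a‖ + ‖b‖))
  simp only [norm_zero, zero_mul] at h0
  rw [tendsto_iff_norm_sub_tendsto_zero]
  refine squeeze_zero' (Eventually.of_forall fun _ => norm_nonneg _) ?_ h0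
  filter_upwards [eventually_gt_atTop 0] with m hm
  have hm' : (0 : ℝ) < m := Nat.cast_pos.2 hm
  set t : ℝ := (m : ℝ)⁻¹ with ht
  have ht0 : 0 < t := inv_pos.2 hm'
  have e1 : exp (a + b) = exp (t • (a + b)) ^ m := by
    rw [← NormedSpace.exp_nsmul, ← Nat.cast_smul_eq_nsmul ℝ m, smul_smul, ht, mul_inv_cancel₀ hm'.ne', one_smul]
  have hn : ∀ c : 𝔸, ‖exp (t • c)‖ ≤ Real.exp (t * ‖c‖) := fun c => by
    have := norm_exp_le_exp_norm (t • c)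
    rwa [norm_smul, Real.norm_of_nonneg ht0.le] at this
  have hX : ‖exp (t • a) * exp (t • b)‖ ≤ Real.exp (t * (‖a‖ + ‖b‖)) := by
    refine (norm_mul_le _ _).trans ?_
    rw [mul_add, Real.exp_add]
    gcongr <;> exact hn _
  have hY : ‖exp (t • (a + b))‖ ≤ Real.exp (t * (‖a‖ + ‖b‖)) :=
    (hn _).trans (Real.exp_le_exp.2 (by gcongr; exact norm_add_le _ _))
  have h := norm_pow_sub_pow_le_of_norm_le (Real.one_le_exp (by positivity)) hX hY m
  rw [← Real.exp_nat_mul, ← mul_assoc, ht, mul_inv_cancel₀ hm'.ne', one_mul, ← ht] at h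
  rw [e1]
  refine h.trans (le_of_eq ?_)
  simp [hf, norm_smul, ht]

end LieTrotter

open NormedSpace Filter Topology in
open scoped Matrix.Norms.L2Operator in
/-- The **Golden-Thompson inequality** for real symmetric matrices. -/
theorem Matrix.IsSymm.trace_exp_add_le {ι : Type*} [Fintype ι] [DecidableEq ι]
    {A B : Matrix ι ι ℝ} (hA : A.IsSymm) (hB : B.IsSymm) :
    trace (NormedSpace.exp (A + B)) ≤ trace (NormedSpace.exp A * NormedSpace.exp B) := by
  cases isEmpty_or_nonempty ι
  · simp [trace]
  -- The trace inequality is available for exponents `2 ^ k`, so the limit is taken along this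
  -- subsequence.
  have h2 : Tendsto (fun k : ℕ => 2 ^ k) atTop atTop :=
    tendsto_pow_atTop_atTop_of_one_lt (by norm_num)
  have hc : Continuous (trace : Matrix ι ι ℝ → ℝ) := continuous_id.matrix_trace
  have ht := (hc.tendsto _).comp ((tendsto_exp_smul_mul_exp_smul_pow A B).comp h2)
  refine le_of_tendsto ht (Eventually.of_forall fun k => ?_)
  have h := (trace_pow_two_pow_le_and k).2 _ _ (hA.smul (((2 ^ k : ℕ) : ℝ)⁻¹)).exp
    (hB.smul (((2 ^ k : ℕ) : ℝ)⁻¹)).exp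
  have e : ∀ C : Matrix ι ι ℝ, NormedSpace.exp (((2 ^ k : ℕ) : ℝ)⁻¹ • C) ^ 2 ^ k =
      NormedSpace.exp C := fun C => by
    rw [← Matrix.exp_nsmul, ← Nat.cast_smul_eq_nsmul ℝ (2 ^ k), smul_smul, mul_inv_cancel₀,
      one_smul]
    positivity
  rw [e, e] at h
  exact h

/-! ### Exponentials of symmetric matrices. -/

section SpectralLemmas

variable {ι : Type*} [Fintype ι] [DecidableEq ι]

theorem Matrix.IsSymm.exists_orthogonal_diagonalization {H : Matrix ι ι ℝ} (hH : H.IsSymm) :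
    ∃ (U : Matrix ι ι ℝ) (d : ι → ℝ), Uᵀ * U = 1 ∧ U * Uᵀ = 1 ∧ H = U * diagonal d * Uᵀ := by
  have hH' : H.IsHermitian := by rwa [IsHermitian, conjTranspose_eq_transpose_of_trivial]
  refine ⟨hH'.eigenvectorUnitary, hH'.eigenvalues, ?_, ?_, ?_⟩
  · have := Unitary.coe_star_mul_self hH'.eigenvectorUnitary
    rwa [star_eq_conjTranspose, conjTranspose_eq_transpose_of_trivial] at this
  · have := Unitary.coe_mul_star_self hH'.eigenvectorUnitary
    rwa [Unitary.coe_star, star_eq_conjTranspose, conjTranspose_eq_transpose_of_trivial] at this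
  · have := hH'.spectral_theorem
    rw [Unitary.conjStarAlgAut_apply, star_eq_conjTranspose,
      conjTranspose_eq_transpose_of_trivial] at this
    exact this

theorem Matrix.exp_orthogonal_conj {U : Matrix ι ι ℝ} (h1 : Uᵀ * U = 1) (h2 : U * Uᵀ = 1)
    (d : ι → ℝ) : NormedSpace.exp (U * diagonal d * Uᵀ) =
      U * diagonal (fun i => Real.exp (d i)) * Uᵀ := by
  have hU : IsUnit U := ⟨⟨U, Uᵀ, h2, h1⟩, rfl⟩
  have hinv : U⁻¹ = Uᵀ := inv_eq_left_inv h1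
  have h := exp_conj U (diagonal d) hU
  rw [hinv, exp_diagonal] at h
  rw [h, Real.exp_eq_exp_ℝ]
  congr 3
  ext i
  exact Pi.coe_exp d i

/-- The trace of the exponential dominates the exponential of every Rayleigh quotient. -/
theorem Matrix.IsSymm.exp_le_trace_exp {H : Matrix ι ι ℝ} (hH : H.IsSymm) {c : ℝ} {x : ι → ℝ}
    (hx : x ≠ 0) (hc : c * (x ⬝ᵥ x) ≤ x ⬝ᵥ H *ᵥ x) :
    Real.exp c ≤ trace (NormedSpace.exp H) := by
  obtain ⟨U, d, h1, h2, rfl⟩ := hH.exists_orthogonal_diagonalization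
  have htr : trace (NormedSpace.exp (U * diagonal d * Uᵀ)) = ∑ i, Real.exp (d i) := by
    rw [exp_orthogonal_conj h1 h2, trace_mul_comm, ← mul_assoc, h1, one_mul, trace_diagonal]
  set y := Uᵀ *ᵥ x with hy
  have hxy : x = U *ᵥ y := by rw [hy, mulVec_mulVec, h2, one_mulVec]
  have hy0 : y ≠ 0 := fun h => hx (by rw [hxy, h, mulVec_zero])
  have e1 : x ⬝ᵥ x = ∑ i, y i * y i := by
    change _ = y ⬝ᵥ y
    conv_rhs => rw [hy, dotProduct_mulVec, vecMul_transpose, ← hy, ← hxy]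
  have e2 : x ⬝ᵥ (U * diagonal d * Uᵀ) *ᵥ x = ∑ i, d i * (y i * y i) := by
    rw [← mulVec_mulVec, ← mulVec_mulVec, ← hy, dotProduct_mulVec, ← mulVec_transpose, ← hy,
      dotProduct]
    refine Finset.sum_congr rfl fun i _ => ?_
    rw [mulVec_diagonal]
    ring
  rw [e1, e2] at hc
  have hi : ∃ i, c ≤ d i := by
    by_contra! hlt
    obtain ⟨j, hj⟩ := Function.ne_iff.1 hy0
    have : ∑ i, d i * (y i * y i) < ∑ i, c * (y i * y i) :=
      Finset.sum_lt_sum (fun i _ => mul_le_mul_of_nonneg_right (hlt i).le (mul_self_nonneg _))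
        ⟨j, Finset.mem_univ _, mul_lt_mul_of_pos_right (hlt j) (mul_self_pos.2 hj)⟩
    rw [← Finset.mul_sum] at this
    linarith
  obtain ⟨i, hi⟩ := hi
  rw [htr]
  exact (Real.exp_le_exp.2 hi).trans
    (Finset.single_le_sum (f := fun i => Real.exp (d i)) (fun i _ => (Real.exp_pos _).le)
      (Finset.mem_univ i))

/-- With `H = exp (Y / 2)` symmetric, the trace equals that of `H * B * H`. -/
theorem Matrix.IsSymm.trace_exp_mul_nonneg {Y B : Matrix ι ι ℝ} (hY : Y.IsSymm)
    (hB : B.PosSemidef) : 0 ≤ trace (NormedSpace.exp Y * B) := by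
  have hH := (hY.smul (1 / 2 : ℝ)).exp
  have e : NormedSpace.exp Y =
      NormedSpace.exp ((1 / 2 : ℝ) • Y) * NormedSpace.exp ((1 / 2 : ℝ) • Y) := by
    rw [← Matrix.exp_add_of_commute _ _ (Commute.refl _), ← add_smul]
    norm_num
  have h := (hB.conjTranspose_mul_mul_same (NormedSpace.exp ((1 / 2 : ℝ) • Y))).trace_nonneg
  rw [conjTranspose_eq_transpose_of_trivial, hH.eq, mul_assoc, trace_mul_comm, mul_assoc, ← e,
    trace_mul_comm] at h
  exact h

open scoped Matrix.Norms.L2Operator in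
theorem Matrix.continuous_exp_apply (i j : ι) :
    Continuous fun B : ι → ι → ℝ => NormedSpace.exp (Matrix.of B) i j := by
  let _ : NormedAlgebra ℚ (Matrix ι ι ℝ) := NormedAlgebra.restrictScalars ℚ ℝ _
  have h : Continuous (NormedSpace.exp : Matrix ι ι ℝ → Matrix ι ι ℝ) := NormedSpace.exp_continuous
  exact (continuous_apply_apply i j).comp (h.comp continuous_id)

end SpectralLemmas

/-! ### The expected trace exponential of an independent sum. -/

section MatrixLaplace

variable {ι κ S : Type*} [Fintype ι] [DecidableEq ι] [DecidableEq κ] [MeasurableSpace S]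
  {P : Measure S}

omit [DecidableEq κ] in
theorem MeasureTheory.Integrable.of_finite_range [IsFiniteMeasure P] {f : S → ℝ}
    (hf : Measurable f) (hr : (Set.range f).Finite) : Integrable f P := by
  obtain ⟨C, hC⟩ := hr.isBounded.exists_norm_le
  exact Integrable.of_bound hf.aestronglyMeasurable C
    (Filter.Eventually.of_forall fun s => hC _ (Set.mem_range_self s))

omit [Fintype ι] [DecidableEq ι] [MeasurableSpace S] in
theorem Set.finite_range_matrix_sum {Z : κ → S → Matrix ι ι ℝ}
    (hfin : ∀ e, (Set.range (Z e)).Finite) (t : Finset κ) :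
    (Set.range fun s => ∑ e ∈ t, Z e s).Finite := by
  induction t using Finset.induction_on with
  | empty => simpa using Set.finite_range_const
  | insert a t ha ih =>
    refine ((hfin a).image2 (· + ·) ih).subset ?_
    rintro _ ⟨s, rfl⟩
    exact ⟨Z a s, ⟨s, rfl⟩, _, ⟨s, rfl⟩, (Finset.sum_insert (f := fun e => Z e s) ha).symm⟩

/-- If independent random symmetric matrices satisfy `𝔼 exp Z ≤ 1` in the semidefinite order, then
the trace exponential of their sum has expectation at most the dimension. -/
theorem integral_trace_exp_sum_le [IsProbabilityMeasure P] {Z : κ → S → Matrix ι ι ℝ}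
    (hsymm : ∀ e s, (Z e s).IsSymm) (hmeas : ∀ e, Measurable fun s i j => Z e s i j)
    (hfin : ∀ e, (Set.range (Z e)).Finite)
    (hind : iIndepFun (fun e s i j => Z e s i j) P)
    (hexp : ∀ e, (1 - Matrix.of fun i j => ∫ s, NormedSpace.exp (Z e s) i j ∂P).PosSemidef)
    (t : Finset κ) :
    ∫ s, trace (NormedSpace.exp (∑ e ∈ t, Z e s)) ∂P ≤ Fintype.card ι := by
  have hms : ∀ t : Finset κ, Measurable fun s i j => (∑ e ∈ t, Z e s) i j :=
    fun t => Finset.measurable_sum (M := ι → ι → ℝ) t fun e _ => hmeas e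
  have hint : ∀ {W : S → Matrix ι ι ℝ}, Measurable (fun s i j => W s i j) →
      (Set.range W).Finite → ∀ i j, Integrable (fun s => NormedSpace.exp (W s) i j) P := by
    intro W hW hWf i j
    refine Integrable.of_finite_range ((continuous_exp_apply i j).measurable.comp hW) ?_
    refine (hWf.image fun B : Matrix ι ι ℝ => NormedSpace.exp B i j).subset ?_
    rintro _ ⟨s, rfl⟩
    exact ⟨W s, ⟨s, rfl⟩, rfl⟩
  have hintt : ∀ t : Finset κ, ∀ i j,
      Integrable (fun s => NormedSpace.exp (∑ e ∈ t, Z e s) i j) P :=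
    fun t => hint (hms t) (Set.finite_range_matrix_sum hfin t)
  have hinttr : ∀ t : Finset κ, ∀ B : Matrix ι ι ℝ,
      Integrable (fun s => trace (NormedSpace.exp (∑ e ∈ t, Z e s) * B)) P := fun t B => by
    simp only [trace, diag_apply, mul_apply]
    exact integrable_finsetSum _ fun i _ => integrable_finsetSum _ fun j _ =>
      (hintt t i j).mul_const _
  induction t using Finset.induction_on with
  | empty => simp
  | insert a t ha ih =>
    set M : Matrix ι ι ℝ := Matrix.of fun i j => ∫ s, NormedSpace.exp (Z a s) i j ∂P with hM
    have hYs : ∀ s, (∑ e ∈ t, Z e s).IsSymm := fun s => by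
      rw [IsSymm, transpose_sum]
      exact Finset.sum_congr rfl fun e _ => hsymm e s
    have hindep : IndepFun (fun s i j => (∑ e ∈ t, Z e s) i j)
        (fun s i j => Z a s i j) P := by
      have := hind.indepFun_finsetSum_of_notMem hmeas ha
      convert this using 1
      ext s
      simp only [Finset.sum_apply, Matrix.sum_apply]
    have hprod : ∀ i j, Integrable
        (fun s => NormedSpace.exp (∑ e ∈ t, Z e s) i j * NormedSpace.exp (Z a s) j i) P :=
      fun i j => (hindep.comp (continuous_exp_apply i j).measurable
        (continuous_exp_apply j i).measurable).integrable_mul (hintt t i j)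
          (hint (hmeas a) (hfin a) j i)
    have hprodi : ∀ i j, ∫ s, NormedSpace.exp (∑ e ∈ t, Z e s) i j *
        NormedSpace.exp (Z a s) j i ∂P =
        ∫ s, NormedSpace.exp (∑ e ∈ t, Z e s) i j * M j i ∂P := fun i j => by
      rw [integral_mul_const]
      exact (hindep.comp (continuous_exp_apply i j).measurable
        (continuous_exp_apply j i).measurable).integral_fun_mul_eq_mul_integral
          (hintt t i j).aestronglyMeasurable (hint (hmeas a) (hfin a) j i).aestronglyMeasurable
    have htr1 : ∀ s, trace (NormedSpace.exp (∑ e ∈ t, Z e s) * NormedSpace.exp (Z a s)) =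
        ∑ i, ∑ j, NormedSpace.exp (∑ e ∈ t, Z e s) i j * NormedSpace.exp (Z a s) j i :=
      fun s => by simp only [trace, diag_apply, mul_apply]
    have htr2 : ∀ s, trace (NormedSpace.exp (∑ e ∈ t, Z e s) * M) =
        ∑ i, ∑ j, NormedSpace.exp (∑ e ∈ t, Z e s) i j * M j i :=
      fun s => by simp only [trace, diag_apply, mul_apply]
    -- Golden-Thompson splits off one summand, independence replaces its exponential by the mean
    -- `M`, and `M ≤ 1` discards it.
    calc ∫ s, trace (NormedSpace.exp (∑ e ∈ insert a t, Z e s)) ∂P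
        ≤ ∫ s, trace (NormedSpace.exp (∑ e ∈ t, Z e s) * NormedSpace.exp (Z a s)) ∂P := by
          refine integral_mono (by simpa using hinttr (insert a t) 1) ?_ fun s => ?_
          · simp only [htr1]
            exact integrable_finsetSum _ fun i _ => integrable_finsetSum _ fun j _ => hprod i j
          · simp only
            rw [Finset.sum_insert ha, add_comm]
            exact (hYs s).trace_exp_add_le (hsymm a s)
      _ = ∫ s, trace (NormedSpace.exp (∑ e ∈ t, Z e s) * M) ∂P := by
          simp only [htr1, htr2]
          rw [integral_finsetSum _ fun i _ => integrable_finsetSum _ fun j _ => hprod i j,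
            integral_finsetSum _ fun i _ => integrable_finsetSum _ fun j _ =>
              (hintt t i j).mul_const _]
          refine Finset.sum_congr rfl fun i _ => ?_
          rw [integral_finsetSum _ fun j _ => hprod i j,
            integral_finsetSum _ fun j _ => (hintt t i j).mul_const _]
          exact Finset.sum_congr rfl fun j _ => hprodi i j
      _ ≤ ∫ s, trace (NormedSpace.exp (∑ e ∈ t, Z e s)) ∂P := by
          refine integral_mono (hinttr t M) (by simpa using hinttr t 1) fun s => ?_
          have := (hYs s).trace_exp_mul_nonneg (hexp a)
          rw [mul_sub, mul_one, trace_sub] at this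
          simp only
          linarith
      _ ≤ _ := ih

end MatrixLaplace

/-! ### A matrix Bernstein inequality for Bernoulli coefficients. -/

section Bernoulli

/-- The term `p * u ^ 2` compensates the exponential moment of a centered Bernoulli variable, by `1
+ x ≤ exp x` and `exp u ≤ 1 + u + u ^ 2` for `|u| ≤ 1`. -/
theorem bernoulli_exp_le_one {p u : ℝ} (hu : |u| ≤ 1) (hp : 0 ≤ p) :
    (1 - p) * Real.exp (-p * u - p * u ^ 2) + p * Real.exp ((1 - p) * u - p * u ^ 2) ≤ 1 := by
  have h1 : (1 - p) * Real.exp (-p * u - p * u ^ 2) + p * Real.exp ((1 - p) * u - p * u ^ 2) =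
      Real.exp (-p * u - p * u ^ 2) * (1 + p * (Real.exp u - 1)) := by
    have : (1 - p) * u - p * u ^ 2 = (-p * u - p * u ^ 2) + u := by ring
    rw [this, Real.exp_add]
    ring
  have h2 : 1 + p * (Real.exp u - 1) ≤ Real.exp (p * (Real.exp u - 1)) := by
    linarith [Real.add_one_le_exp (p * (Real.exp u - 1))]
  have h3 := (abs_le.1 (Real.abs_exp_sub_one_sub_id_le hu)).2
  rw [h1]
  calc _ ≤ Real.exp (-p * u - p * u ^ 2) * Real.exp (p * (Real.exp u - 1)) := by gcongr
    _ = Real.exp (p * (Real.exp u - 1 - u - u ^ 2)) := by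
      rw [← Real.exp_add]; congr 1; ring
    _ ≤ 1 := Real.exp_le_one_iff.2 (mul_nonpos_of_nonneg_of_nonpos hp (by linarith))

variable {ι : Type*} [Fintype ι] [DecidableEq ι]

theorem Matrix.IsSymm.posSemidef_one_sub_bernoulli_exp {K : Matrix ι ι ℝ} (hK : K.IsSymm)
    {p θ : ℝ} (hp : 0 ≤ p)
    (hb : ∀ x : ι → ℝ, θ ^ 2 * (K *ᵥ x ⬝ᵥ K *ᵥ x) ≤ x ⬝ᵥ x) :
    (1 - ((1 - p) • NormedSpace.exp ((θ * (0 - p)) • K - (θ ^ 2 * p) • (K * K)) +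
      p • NormedSpace.exp ((θ * (1 - p)) • K - (θ ^ 2 * p) • (K * K)))).PosSemidef := by
  obtain ⟨U, d, h1, h2, hKd⟩ := hK.exists_orthogonal_diagonalization
  have hKK : K * K = U * diagonal (fun i => d i * d i) * Uᵀ := by
    rw [hKd, ← diagonal_mul_diagonal]
    calc _ = U * diagonal d * (Uᵀ * U) * diagonal d * Uᵀ := by simp only [mul_assoc]
      _ = _ := by rw [h1, mul_one]; simp only [mul_assoc]
  have hlin : ∀ a b : ℝ, a • K - b • (K * K) =
      U * diagonal (fun i => a * d i - b * (d i * d i)) * Uᵀ := fun a b => by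
    have : diagonal (fun i => a * d i - b * (d i * d i)) =
        a • diagonal d - b • diagonal (fun i => d i * d i) := by
      rw [← diagonal_smul, ← diagonal_smul, diagonal_sub]; rfl
    rw [this, hKK, hKd]
    simp only [mul_sub, sub_mul, mul_smul_comm, smul_mul_assoc]
  -- Testing `hb` on an eigenvector bounds the eigenvalue; the scalar inequality then applies with
  -- `u = θ * d i`.
  have hd : ∀ i, |θ * d i| ≤ 1 := fun i => by
    have h := hb (U *ᵥ Pi.single i 1)
    have e1 : K *ᵥ (U *ᵥ Pi.single i 1) = d i • (U *ᵥ Pi.single i 1) := by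
      rw [hKd, mulVec_mulVec, mul_assoc, h1, mul_one, ← mulVec_mulVec, ← mulVec_smul]
      congr 1
      ext j
      rw [mulVec_diagonal]
      by_cases hj : j = i <;> simp [hj]
    have e2 : U *ᵥ Pi.single i 1 ⬝ᵥ U *ᵥ Pi.single i 1 = 1 := by
      rw [dotProduct_mulVec, ← mulVec_transpose, mulVec_mulVec, h1, one_mulVec]
      simp
    rw [e1, smul_dotProduct, dotProduct_smul, e2] at h
    rw [← sq_le_one_iff_abs_le_one]
    simp only [smul_eq_mul] at h
    nlinarith
  rw [hlin, hlin, exp_orthogonal_conj h1 h2, exp_orthogonal_conj h1 h2]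
  set f0 := fun i => Real.exp (θ * (0 - p) * d i - θ ^ 2 * p * (d i * d i))
  set f1 := fun i => Real.exp (θ * (1 - p) * d i - θ ^ 2 * p * (d i * d i))
  have e : (1 - ((1 - p) • (U * diagonal f0 * Uᵀ) + p • (U * diagonal f1 * Uᵀ))) =
      U * diagonal (fun i => 1 - ((1 - p) * f0 i + p * f1 i)) * Uᴴ := by
    have : diagonal (fun i => 1 - ((1 - p) * f0 i + p * f1 i)) =
        1 - ((1 - p) • diagonal f0 + p • diagonal f1) := by
      rw [← diagonal_smul, ← diagonal_smul, diagonal_add, ← diagonal_one, diagonal_sub]; rfl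
    rw [this, conjTranspose_eq_transpose_of_trivial]
    simp only [mul_sub, sub_mul, mul_add, add_mul, mul_smul_comm, smul_mul_assoc, mul_one, h2]
  rw [e]
  refine (PosSemidef.diagonal fun i => ?_).mul_mul_conjTranspose_same U
  have h := bernoulli_exp_le_one (hd i) hp
  have a0 : θ * (0 - p) * d i - θ ^ 2 * p * (d i * d i) =
    -p * (θ * d i) - p * (θ * d i) ^ 2 := by ring
  have a1 : θ * (1 - p) * d i - θ ^ 2 * p * (d i * d i) =
    (1 - p) * (θ * d i) - p * (θ * d i) ^ 2 := by ring
  simp only [Pi.zero_apply, f0, f1, a0, a1]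
  linarith

variable {κ S : Type*} [Fintype κ] [DecidableEq κ] [MeasurableSpace S]
  {P : Measure S}

/-- A Bernstein type upper tail bound for the quadratic form of a sum of fixed symmetric matrices
with independent centered Bernoulli coefficients. -/
theorem measureReal_exists_quadraticForm_gt_le [IsProbabilityMeasure P] {ξ : κ → S → ℝ}
    {p : κ → ℝ} {K : κ → Matrix ι ι ℝ} {θ v : ℝ}
    (hmeas : ∀ e, Measurable (ξ e)) (h01 : ∀ e s, ξ e s = 0 ∨ ξ e s = 1)
    (hind : iIndepFun ξ P) (hp : ∀ e, 0 ≤ p e) (hmean : ∀ e, ∫ s, ξ e s ∂P = p e)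
    (hK : ∀ e, (K e).IsSymm) (hθ : 0 < θ)
    (hb : ∀ e (x : ι → ℝ), θ ^ 2 * (K e *ᵥ x ⬝ᵥ K e *ᵥ x) ≤ x ⬝ᵥ x)
    (hv : ∀ x : ι → ℝ, ∑ e, p e * (K e *ᵥ x ⬝ᵥ K e *ᵥ x) ≤ v * (x ⬝ᵥ x)) (r : ℝ) :
    P.real {s | ∃ x : ι → ℝ, r * (x ⬝ᵥ x) < x ⬝ᵥ (∑ e, (ξ e s - p e) • K e) *ᵥ x} ≤
      Fintype.card ι * Real.exp (-(θ * r - θ ^ 2 * v)) := by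
  -- With the compensator inside the exponent, the variances are added as matrices before `hv`
  -- bounds them, so `v` bounds the sum and not each summand separately.
  set z : κ → ℝ → Matrix ι ι ℝ := fun e y => (θ * (y - p e)) • K e - (θ ^ 2 * p e) • (K e * K e)
    with hz
  set Z : κ → S → Matrix ι ι ℝ := fun e s => z e (ξ e s) with hZ
  have hKK : ∀ e, (K e * K e).IsSymm := fun e => by rw [IsSymm, transpose_mul, (hK e).eq]
  have hsymm : ∀ e s, (Z e s).IsSymm := fun e s => ((hK e).smul _).sub ((hKK e).smul _)
  have hzc : ∀ e, Measurable fun y i j => z e y i j := fun e => by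
    refine measurable_pi_iff.2 fun i => measurable_pi_iff.2 fun j => ?_
    change Measurable fun y => (θ * (y - p e)) * K e i j - (θ ^ 2 * p e) * (K e * K e) i j
    fun_prop
  have hZm : ∀ e, Measurable fun s i j => Z e s i j := fun e => (hzc e).comp (hmeas e)
  have hfin : ∀ e, (Set.range (Z e)).Finite := fun e => by
    refine ((Set.toFinite {(0 : ℝ), 1}).image (z e)).subset ?_
    rintro _ ⟨s, rfl⟩
    exact ⟨ξ e s, by simpa using h01 e s, rfl⟩
  have hZind : iIndepFun (fun e s i j => Z e s i j) P := hind.comp _ hzc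
  have hexp : ∀ e, (1 - Matrix.of fun i j => ∫ s, NormedSpace.exp (Z e s) i j ∂P).PosSemidef := by
    intro e
    convert (hK e).posSemidef_one_sub_bernoulli_exp (hp e) (hb e) using 2
    ext i j
    -- On `{0, 1}` every function of `ξ` is affine, so its mean depends on `p e` alone.
    have hs : ∀ s, NormedSpace.exp (Z e s) i j = NormedSpace.exp (z e 0) i j +
        ξ e s * (NormedSpace.exp (z e 1) i j - NormedSpace.exp (z e 0) i j) := fun s => by
      rcases h01 e s with h | h <;> simp [hZ, h]
    have hξ : Integrable (ξ e) P := Integrable.of_finite_range (hmeas e) <|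
      (Set.toFinite {(0 : ℝ), 1}).subset (by rintro _ ⟨s, rfl⟩; simpa using h01 e s)
    simp only [of_apply, hs]
    rw [integral_add (integrable_const _) (hξ.mul_const _), integral_mul_const, hmean]
    simp [hz]
    ring
  have hE := integral_trace_exp_sum_le hsymm hZm hfin hZind hexp Finset.univ
  set c := θ * r - θ ^ 2 * v
  have hYs : ∀ s, (∑ e, Z e s).IsSymm := fun s => by
    rw [IsSymm, transpose_sum]
    exact Finset.sum_congr rfl fun e _ => hsymm e s
  have htr0 : ∀ s, 0 ≤ trace (NormedSpace.exp (∑ e, Z e s)) := fun s => by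
    simpa using (hYs s).trace_exp_mul_nonneg PosSemidef.one
  have hti : Integrable (fun s => trace (NormedSpace.exp (∑ e, Z e s))) P := by
    refine Integrable.of_finite_range ?_ ?_
    · have hm : Measurable fun s i j => (∑ e, Z e s) i j :=
        Finset.measurable_sum (M := ι → ι → ℝ) _ fun e _ => hZm e
      simp only [trace, diag_apply]
      exact Finset.measurable_sum _ fun i _ => (continuous_exp_apply i i).measurable.comp hm
    · refine ((Set.finite_range_matrix_sum hfin Finset.univ).image
        fun B : Matrix ι ι ℝ => trace (NormedSpace.exp B)).subset ?_
      rintro _ ⟨s, rfl⟩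
      exact ⟨_, ⟨s, rfl⟩, rfl⟩
  have hsub : {s | ∃ x : ι → ℝ, r * (x ⬝ᵥ x) < x ⬝ᵥ (∑ e, (ξ e s - p e) • K e) *ᵥ x} ⊆
      {s | Real.exp c ≤ trace (NormedSpace.exp (∑ e, Z e s))} := by
    rintro s ⟨x, hx⟩
    have hx0 : x ≠ 0 := by rintro rfl; simp at hx
    refine (hYs s).exp_le_trace_exp hx0 ?_
    have e1 : ∑ e, Z e s =
        θ • ∑ e, (ξ e s - p e) • K e - θ ^ 2 • ∑ e, p e • (K e * K e) := by
      simp only [hZ, hz, Finset.sum_sub_distrib, Finset.smul_sum, smul_smul]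
    have e2 : x ⬝ᵥ (∑ e, p e • (K e * K e)) *ᵥ x = ∑ e, p e * (K e *ᵥ x ⬝ᵥ K e *ᵥ x) := by
      rw [sum_mulVec, dotProduct_sum]
      refine Finset.sum_congr rfl fun e _ => ?_
      rw [smul_mulVec, dotProduct_smul, ← mulVec_mulVec, dotProduct_mulVec, ← mulVec_transpose,
        (hK e).eq, smul_eq_mul]
    rw [e1, sub_mulVec, smul_mulVec, smul_mulVec, dotProduct_sub, dotProduct_smul,
      dotProduct_smul, e2, smul_eq_mul, smul_eq_mul]
    have := mul_le_mul_of_nonneg_left (hv x) (sq_nonneg θ)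
    have := mul_lt_mul_of_pos_left hx hθ
    simp only [c]
    nlinarith
  have hmk := mul_meas_ge_le_integral_of_nonneg (Filter.Eventually.of_forall htr0) hti (Real.exp c)
  calc _ ≤ P.real {s | Real.exp c ≤ trace (NormedSpace.exp (∑ e, Z e s))} := measureReal_mono hsub
    _ ≤ _ := by
      rw [Real.exp_neg, ← div_eq_mul_inv, le_div_iff₀' (Real.exp_pos _)]
      exact hmk.trans hE

end Bernoulli

/-! ### Matrices attached to single edges. -/

namespace SBM

theorem degree_eq_sum {n : ℕ} (B : Matrix (Fin n) (Fin n) ℝ) (i : Fin n) :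
    degree B i = ∑ j, B i j := by
  simp [degree, mulVec, dotProduct]

section Edge

variable {n : ℕ}

/-- The unordered pair of two nodes, represented with its entries in increasing order. -/
def edge (a c : Fin n) : {e : Fin n × Fin n // e.1 ≤ e.2} :=
  ⟨(min a c, max a c), min_le_max⟩

theorem edge_comm (a c : Fin n) : edge a c = edge c a := by
  simp [edge, min_comm, max_comm]

theorem edge_right_injective (a : Fin n) : Function.Injective (edge a) := by
  intro c c' h
  simp only [edge, Subtype.mk.injEq, Prod.mk.injEq, Fin.ext_iff, Fin.coe_min, Fin.coe_max] at h
  omega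

theorem _root_.Matrix.IsSymm.apply_edge {B : Matrix (Fin n) (Fin n) ℝ} (hB : B.IsSymm)
    (a c : Fin n) : B (edge a c).1.1 (edge a c).1.2 = B a c := by
  rcases le_total a c with h | h
  · simp [edge, h]
  · simpa [edge, h] using hB.apply a c

/-- A node and an edge determine the other endpoint, so these sums have at most one nonzero term.
This treats self-loops and proper edges uniformly. -/
theorem sum_ite_edge_eq_or (a : Fin n) (e : {e : Fin n × Fin n // e.1 ≤ e.2}) :
    (∃ c₀, ∀ g : Fin n → ℝ, ∑ c, (if edge a c = e then g c else 0) = g c₀) ∨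
      ∀ g : Fin n → ℝ, ∑ c, (if edge a c = e then g c else 0) = 0 := by
  by_cases h : ∃ c₀, edge a c₀ = e
  · obtain ⟨c₀, rfl⟩ := h
    exact Or.inl ⟨c₀, fun g => by simp [(edge_right_injective a).eq_iff]⟩
  · push Not at h
    exact Or.inr fun g => by simp [h]

theorem sum_ite_edge_sq (a : Fin n) (e : {e : Fin n × Fin n // e.1 ≤ e.2}) (g : Fin n → ℝ) :
    (∑ c, if edge a c = e then g c else 0) ^ 2 = ∑ c, if edge a c = e then g c ^ 2 else 0 := by
  rcases sum_ite_edge_eq_or a e with ⟨c₀, h⟩ | h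
  · rw [h, h]
  · rw [h, h]; simp

theorem sum_ite_edge_le (a : Fin n) (e : {e : Fin n × Fin n // e.1 ≤ e.2}) {g : Fin n → ℝ} {C : ℝ}
    (hC : 0 ≤ C) (hg : ∀ c, g c ≤ C) : (∑ c, if edge a c = e then g c else 0) ≤ C := by
  rcases sum_ite_edge_eq_or a e with ⟨c₀, h⟩ | h
  · rw [h]; exact hg c₀
  · rwa [h]

/-- The part of the weighted adjacency matrix `w` carried by a single edge. -/
def edgeMatrix (w : Matrix (Fin n) (Fin n) ℝ) (e : {e : Fin n × Fin n // e.1 ≤ e.2}) :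
    Matrix (Fin n) (Fin n) ℝ :=
  Matrix.of fun a c => if edge a c = e then w a c else 0

/-- The diagonal matrix of weighted incidences of nodes with a single edge. -/
def incidenceMatrix (w : Fin n → ℝ) (e : {e : Fin n × Fin n // e.1 ≤ e.2}) :
    Matrix (Fin n) (Fin n) ℝ :=
  Matrix.diagonal fun a => ∑ c, if edge a c = e then w a else 0

theorem edgeMatrix_isSymm {w : Matrix (Fin n) (Fin n) ℝ} (hw : w.IsSymm)
    (e : {e : Fin n × Fin n // e.1 ≤ e.2}) : (edgeMatrix w e).IsSymm := by
  ext a c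
  simp [edgeMatrix, edge_comm c a, hw.apply a c]

theorem incidenceMatrix_isSymm (w : Fin n → ℝ) (e : {e : Fin n × Fin n // e.1 ≤ e.2}) :
    (incidenceMatrix w e).IsSymm := isSymm_diagonal _

theorem sum_smul_edgeMatrix_apply (w : Matrix (Fin n) (Fin n) ℝ)
    (f : {e : Fin n × Fin n // e.1 ≤ e.2} → ℝ) (a c : Fin n) :
    (∑ e, f e • edgeMatrix w e) a c = f (edge a c) * w a c := by
  simp [Matrix.sum_apply, edgeMatrix]

theorem sum_smul_incidenceMatrix (w : Fin n → ℝ)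
    (f : {e : Fin n × Fin n // e.1 ≤ e.2} → ℝ) :
    ∑ e, f e • incidenceMatrix w e = Matrix.diagonal fun a => (∑ c, f (edge a c)) * w a := by
  ext a b
  by_cases hab : a = b
  · subst hab
    simp only [Matrix.sum_apply, incidenceMatrix, Matrix.smul_apply, diagonal_apply_eq, smul_eq_mul,
      Finset.mul_sum, Finset.sum_mul]
    rw [Finset.sum_comm]
    simp
  · simp [Matrix.sum_apply, incidenceMatrix, hab]

theorem edgeMatrix_mulVec_dotProduct_self (w : Matrix (Fin n) (Fin n) ℝ)
    (e : {e : Fin n × Fin n // e.1 ≤ e.2}) (x : Fin n → ℝ) :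
    edgeMatrix w e *ᵥ x ⬝ᵥ edgeMatrix w e *ᵥ x =
      ∑ a, ∑ c, if edge a c = e then (w a c * x c) ^ 2 else 0 := by
  refine Finset.sum_congr rfl fun a _ => ?_
  rw [← sum_ite_edge_sq, ← pow_two]
  simp [mulVec, dotProduct, edgeMatrix, ite_mul]

theorem incidenceMatrix_mulVec_dotProduct_self (w : Fin n → ℝ)
    (e : {e : Fin n × Fin n // e.1 ≤ e.2}) (x : Fin n → ℝ) :
    incidenceMatrix w e *ᵥ x ⬝ᵥ incidenceMatrix w e *ᵥ x =
      ∑ a, ∑ c, if edge a c = e then (w a * x a) ^ 2 else 0 := by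
  refine Finset.sum_congr rfl fun a _ => ?_
  rw [← sum_ite_edge_sq, ← pow_two, incidenceMatrix, mulVec_diagonal, Finset.sum_mul]
  simp [ite_mul]

theorem sum_mul_sum_ite_edge (f : {e : Fin n × Fin n // e.1 ≤ e.2} → ℝ) (g : Fin n → Fin n → ℝ) :
    ∑ e, f e * ∑ a, ∑ c, (if edge a c = e then g a c else 0) =
      ∑ a, ∑ c, f (edge a c) * g a c := by
  simp only [Finset.mul_sum]
  rw [Finset.sum_comm]
  refine Finset.sum_congr rfl fun a _ => ?_
  rw [Finset.sum_comm]
  simp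

end Edge

/-! ### Tail bounds for the adjacency matrix and the degrees. -/

namespace Model

variable {n k : ℕ} {M : Model n k}

theorem expectedAdjacency_isSymm (M : Model n k) : M.expectedAdjacency.IsSymm := by
  ext i j
  simp [expectedAdjacency_apply, M.affinity_symm.apply]

theorem expectedAdjacency_nonneg (M : Model n k) (i j : Fin n) : 0 ≤ M.expectedAdjacency i j := by
  rw [expectedAdjacency_apply]; exact M.affinity_nonneg _ _

theorem minExpectedDegree_le (M : Model n k) (i : Fin n) :
    M.minExpectedDegree ≤ degree M.expectedAdjacency i :=
  ciInf_le (Set.finite_range _).bddBelow i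

variable {S : Type*} [MeasurableSpace S] {P : Measure S} [IsProbabilityMeasure P]
  {A : S → Matrix (Fin n) (Fin n) ℝ}

/-- The choice `θ = r * δ / 2` maximizes `θ * r - θ ^ 2 / δ`, with value `r ^ 2 * δ / 4`. The `2` in
`hb` is slack. -/
theorem Generates.measureReal_exists_quadraticForm_gt_le (hA : M.Generates P A)
    {K : {e : Fin n × Fin n // e.1 ≤ e.2} → Matrix (Fin n) (Fin n) ℝ} {δ r : ℝ}
    (hδ : 0 < δ) (hr : 0 < r) (hr1 : r ≤ 1) (hK : ∀ e, (K e).IsSymm)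
    (hb : ∀ e (x : Fin n → ℝ), K e *ᵥ x ⬝ᵥ K e *ᵥ x ≤ 2 / δ ^ 2 * (x ⬝ᵥ x))
    (hv : ∀ x : Fin n → ℝ, ∑ e : {e : Fin n × Fin n // e.1 ≤ e.2},
      M.expectedAdjacency e.1.1 e.1.2 * (K e *ᵥ x ⬝ᵥ K e *ᵥ x) ≤ 1 / δ * (x ⬝ᵥ x)) :
    P.real {s | ∃ x : Fin n → ℝ, r * (x ⬝ᵥ x) < x ⬝ᵥ
      (∑ e, (A s e.1.1 e.1.2 - M.expectedAdjacency e.1.1 e.1.2) • K e) *ᵥ x} ≤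
      n * Real.exp (-(r ^ 2 * δ / 4)) := by
  have h := _root_.measureReal_exists_quadraticForm_gt_le (P := P)
    (ξ := fun (e : {e : Fin n × Fin n // e.1 ≤ e.2}) s => A s e.1.1 e.1.2)
    (p := fun e => M.expectedAdjacency e.1.1 e.1.2) (K := K) (θ := r * δ / 2) (v := 1 / δ)
    (fun e => hA.measurable_entry _ _) (fun e s => hA.zero_or_one s _ _) hA.indep
    (fun e => M.expectedAdjacency_nonneg _ _) (fun e => hA.integral_entry _ _) hK (by positivity)
    (fun e x => ?_) hv r
  · refine h.trans (le_of_eq ?_)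
    rw [Fintype.card_fin]
    congr 3
    field_simp
    norm_num
  · have hx : 0 ≤ x ⬝ᵥ x := Finset.sum_nonneg fun i _ => mul_self_nonneg _
    calc (r * δ / 2) ^ 2 * (K e *ᵥ x ⬝ᵥ K e *ᵥ x) ≤ (r * δ / 2) ^ 2 * (2 / δ ^ 2 * (x ⬝ᵥ x)) := by
          gcongr; exact hb e x
      _ = r ^ 2 / 2 * (x ⬝ᵥ x) := by field_simp
      _ ≤ 1 * (x ⬝ᵥ x) := by gcongr; nlinarith
      _ = _ := one_mul _

variable {δ r : ℝ}

/-- One-sided tail bound for the adjacency matrix normalized by the expected degrees. -/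
theorem Generates.measureReal_adjacency_gt_le (hA : M.Generates P A)
    (hδ : 0 < δ) (hδd : ∀ i, δ ≤ degree M.expectedAdjacency i) (hr : 0 < r) (hr1 : r ≤ 1)
    {σ : ℝ} (hσ : σ ^ 2 = 1) {q : Fin n → ℝ}
    (hq : ∀ i, q i ^ 2 = 1 / degree M.expectedAdjacency i) :
    P.real {s | ∃ x : Fin n → ℝ, r * (x ⬝ᵥ x) < σ * (x ⬝ᵥ
      (diagonal q * (A s - M.expectedAdjacency) * diagonal q) *ᵥ x)} ≤
      n * Real.exp (-(r ^ 2 * δ / 4)) := by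
  -- The sign goes into the weights, so that `σ = 1` and `σ = -1` yield the two tails.
  set w : Matrix (Fin n) (Fin n) ℝ := Matrix.of fun a c => σ * (q a * q c) with hw
  have hws : w.IsSymm := by ext a c; simp [hw, mul_comm]
  have hd : ∀ i, 0 < degree M.expectedAdjacency i := fun i => hδ.trans_le (hδd i)
  have hqδ : ∀ i, q i ^ 2 ≤ 1 / δ := fun i => by
    rw [hq]; exact one_div_le_one_div_of_le hδ (hδd i)
  have hw2 : ∀ a c, w a c ^ 2 = q a ^ 2 * q c ^ 2 := fun a c => by
    simp only [hw, of_apply, mul_pow, hσ, one_mul]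
  have hwδ : ∀ a c, w a c ^ 2 ≤ 1 / δ ^ 2 := fun a c => by
    rw [hw2, show 1 / δ ^ 2 = 1 / δ * (1 / δ) by field_simp]
    exact mul_le_mul (hqδ a) (hqδ c) (sq_nonneg _) (by positivity)
  have h := hA.measureReal_exists_quadraticForm_gt_le hδ hr hr1 (edgeMatrix_isSymm hws)
    (fun e x => ?_) (fun x => ?_)
  · convert h using 6 with s x
    have : ∑ e : {e : Fin n × Fin n // e.1 ≤ e.2},
        (A s e.1.1 e.1.2 - M.expectedAdjacency e.1.1 e.1.2) • edgeMatrix w e =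
        σ • (diagonal q * (A s - M.expectedAdjacency) * diagonal q) := by
      ext a c
      rw [sum_smul_edgeMatrix_apply w
        (fun e => A s e.1.1 e.1.2 - M.expectedAdjacency e.1.1 e.1.2),
        (hA.symm s).apply_edge, M.expectedAdjacency_isSymm.apply_edge]
      simp [hw, diagonal_mul, mul_diagonal]
      ring
    rw [this, smul_mulVec, dotProduct_smul, smul_eq_mul]
  · rw [edgeMatrix_mulVec_dotProduct_self, Finset.sum_comm, dotProduct, Finset.mul_sum]
    refine Finset.sum_le_sum fun c _ => ?_
    simp only [edge_comm _ c]
    refine sum_ite_edge_le c e (by have := mul_self_nonneg (x c); positivity) fun a => ?_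
    rw [mul_pow, pow_two (x c)]
    refine mul_le_mul_of_nonneg_right ((hwδ a c).trans ?_) (mul_self_nonneg _)
    gcongr
    norm_num
  · simp only [edgeMatrix_mulVec_dotProduct_self]
    rw [sum_mul_sum_ite_edge (fun e => M.expectedAdjacency e.1.1 e.1.2), Finset.sum_comm,
      dotProduct, Finset.mul_sum]
    refine Finset.sum_le_sum fun c _ => ?_
    -- One factor `q a ^ 2` is bounded by `1 / δ`; the other, `q c ^ 2`, cancels the expected degree
    -- of `c`.
    calc ∑ a, M.expectedAdjacency (edge a c).1.1 (edge a c).1.2 * (w a c * x c) ^ 2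
        ≤ ∑ a, M.expectedAdjacency c a * (1 / δ * q c ^ 2 * x c ^ 2) := by
          refine Finset.sum_le_sum fun a _ => ?_
          rw [edge_comm, M.expectedAdjacency_isSymm.apply_edge, mul_pow, hw2]
          refine mul_le_mul_of_nonneg_left ?_ (M.expectedAdjacency_nonneg _ _)
          gcongr
          exact hqδ a
      _ = 1 / δ * (x c * x c) := by
          rw [← Finset.sum_mul, ← degree_eq_sum, hq]
          have := (hd c).ne'
          field_simp

/-- One-sided tail bound for the relative deviations of the degrees. -/
theorem Generates.measureReal_degree_gt_le (hA : M.Generates P A)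
    (hδ : 0 < δ) (hδd : ∀ i, δ ≤ degree M.expectedAdjacency i) (hr : 0 < r) (hr1 : r ≤ 1)
    {σ : ℝ} (hσ : σ ^ 2 = 1) :
    P.real {s | ∃ i, r * degree M.expectedAdjacency i <
      σ * (degree (A s) i - degree M.expectedAdjacency i)} ≤
      n * Real.exp (-(r ^ 2 * δ / 4)) := by
  have hd : ∀ i, 0 < degree M.expectedAdjacency i := fun i => hδ.trans_le (hδd i)
  set w : Fin n → ℝ := fun a => σ / degree M.expectedAdjacency a with hw
  have hw2 : ∀ a, w a ^ 2 = 1 / degree M.expectedAdjacency a ^ 2 := fun a => by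
    simp only [hw, div_pow, hσ]
  have h := hA.measureReal_exists_quadraticForm_gt_le hδ hr hr1 (incidenceMatrix_isSymm w)
    (fun e x => ?_) (fun x => ?_)
  · refine (measureReal_mono ?_).trans h
    rintro s ⟨i, hi⟩
    -- The sum is diagonal, so a basis vector reads off the relative deviation at node `i`.
    refine ⟨Pi.single i 1, ?_⟩
    rw [sum_smul_incidenceMatrix w
        (fun e => A s e.1.1 e.1.2 - M.expectedAdjacency e.1.1 e.1.2)]
    have e : (∑ c, (A s (edge i c).1.1 (edge i c).1.2 -
        M.expectedAdjacency (edge i c).1.1 (edge i c).1.2)) =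
        degree (A s) i - degree M.expectedAdjacency i := by
      simp only [(hA.symm s).apply_edge, M.expectedAdjacency_isSymm.apply_edge,
        Finset.sum_sub_distrib, degree_eq_sum]
    simp only [mulVec_single_one, single_dotProduct, Pi.single_eq_same, one_mul, mul_one, col_apply,
      diagonal_apply_eq, e, hw]
    rw [← mul_div_assoc, lt_div_iff₀ (hd i)]
    linarith
  · rw [incidenceMatrix_mulVec_dotProduct_self, dotProduct, Finset.mul_sum]
    refine Finset.sum_le_sum fun a _ => ?_
    refine sum_ite_edge_le a e (by have := mul_self_nonneg (x a); positivity) fun c => ?_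
    rw [mul_pow, pow_two (x a), hw2]
    refine mul_le_mul_of_nonneg_right ?_ (mul_self_nonneg _)
    have := hδd a
    gcongr
    norm_num
  · simp only [incidenceMatrix_mulVec_dotProduct_self]
    rw [sum_mul_sum_ite_edge (fun e => M.expectedAdjacency e.1.1 e.1.2),
      dotProduct, Finset.mul_sum]
    refine Finset.sum_le_sum fun a _ => ?_
    simp only [M.expectedAdjacency_isSymm.apply_edge]
    rw [← Finset.sum_mul, ← degree_eq_sum, mul_pow, hw2, ← pow_two]
    have h1 := one_div_le_one_div_of_le hδ (hδd a)
    have h2 := (hd a).ne'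
    calc _ = 1 / degree M.expectedAdjacency a * x a ^ 2 := by field_simp
      _ ≤ _ := by gcongr

end Model

/-! ### Deterministic perturbation of the normalized matrix. -/

section Deterministic

open scoped Matrix.Norms.L2Operator

variable {n : ℕ}

theorem spectralNorm_eq_norm (B : Matrix (Fin n) (Fin n) ℝ) : spectralNorm B = ‖B‖ := rfl

theorem _root_.Matrix.IsSymm.l2_opNorm_le {B : Matrix (Fin n) (Fin n) ℝ} (hB : B.IsSymm) {r : ℝ}
    (hr : 0 ≤ r) (h : ∀ x : Fin n → ℝ, |x ⬝ᵥ B *ᵥ x| ≤ r * (x ⬝ᵥ x)) : ‖B‖ ≤ r := by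
  rw [← l2_opNorm_toEuclideanCLM]
  set T := toEuclideanCLM (n := Fin n) (𝕜 := ℝ) B with hT
  have hsymm : (T : EuclideanSpace ℝ (Fin n) →ₗ[ℝ] EuclideanSpace ℝ (Fin n)).IsSymmetric := by
    rw [hT, coe_toEuclideanCLM_eq_toEuclideanLin]
    exact isSymmetric_toEuclideanLin_iff.2
      (by rwa [IsHermitian, conjTranspose_eq_transpose_of_trivial])
  rw [T.norm_eq_iSup_rayleighQuotient hsymm]
  refine ciSup_le fun x => ?_
  have e : T.reApplyInnerSelf x = x.ofLp ⬝ᵥ B *ᵥ x.ofLp := by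
    rw [ContinuousLinearMap.reApplyInnerSelf_apply, real_inner_comm, hT, inner_toEuclideanCLM]
    rfl
  have e2 : ‖x‖ ^ 2 = x.ofLp ⬝ᵥ x.ofLp := by
    rw [EuclideanSpace.real_norm_sq_eq]
    simp [dotProduct, pow_two]
  rw [ContinuousLinearMap.rayleighQuotient, e, e2, abs_div,
    abs_of_nonneg (show 0 ≤ x.ofLp ⬝ᵥ x.ofLp from e2 ▸ sq_nonneg _)]
  exact div_le_of_le_mul₀ (e2 ▸ sq_nonneg _) hr (h _)

/-- Use `2 * |y i * y j| ≤ y i ^ 2 + y j ^ 2` and symmetry. -/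
theorem _root_.Matrix.IsSymm.abs_dotProduct_mulVec_le {B : Matrix (Fin n) (Fin n) ℝ}
    (hB : B.IsSymm) (h0 : ∀ i j, 0 ≤ B i j) (y : Fin n → ℝ) :
    |y ⬝ᵥ B *ᵥ y| ≤ ∑ i, degree B i * y i ^ 2 := by
  have e1 : y ⬝ᵥ B *ᵥ y = ∑ i, ∑ j, B i j * (y i * y j) := by
    simp only [dotProduct, mulVec, Finset.mul_sum]
    exact Finset.sum_congr rfl fun i _ => Finset.sum_congr rfl fun j _ => by ring
  have e2 : ∑ i, degree B i * y i ^ 2 = ∑ i, ∑ j, B i j * ((y i ^ 2 + y j ^ 2) / 2) := by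
    have a1 : ∑ i, degree B i * y i ^ 2 = ∑ i, ∑ j, B i j * y i ^ 2 := by
      simp only [degree_eq_sum, Finset.sum_mul]
    have a2 : ∑ i, ∑ j, B i j * y i ^ 2 = ∑ i, ∑ j, B i j * y j ^ 2 := by
      rw [Finset.sum_comm]
      exact Finset.sum_congr rfl fun i _ => Finset.sum_congr rfl fun j _ => by rw [hB.apply]
    have a3 : ∑ i, ∑ j, B i j * ((y i ^ 2 + y j ^ 2) / 2) =
        (∑ i, ∑ j, B i j * y i ^ 2 + ∑ i, ∑ j, B i j * y j ^ 2) / 2 := by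
      simp only [← Finset.sum_add_distrib, Finset.sum_div]
      exact Finset.sum_congr rfl fun i _ => Finset.sum_congr rfl fun j _ => by ring
    rw [a3, ← a2, a1]
    ring
  rw [e1, e2]
  refine (Finset.abs_sum_le_sum_abs _ _).trans (Finset.sum_le_sum fun i _ =>
    (Finset.abs_sum_le_sum_abs _ _).trans (Finset.sum_le_sum fun j _ => ?_))
  rw [abs_mul, abs_of_nonneg (h0 i j)]
  refine mul_le_mul_of_nonneg_left (abs_le.2 ⟨?_, ?_⟩) (h0 i j)
  · nlinarith [sq_nonneg (y i + y j)]
  · nlinarith [sq_nonneg (y i - y j)]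

theorem rpow_neg_half_sq {d : ℝ} (hd : 0 < d) : (d ^ (-(1 / 2 : ℝ))) ^ 2 = 1 / d := by
  rw [← Real.rpow_natCast, ← Real.rpow_mul hd.le]
  norm_num [Real.rpow_neg_one]

theorem diagonal_mul_mul_diagonal_isSymm {B : Matrix (Fin n) (Fin n) ℝ} (hB : B.IsSymm)
    (q : Fin n → ℝ) : (diagonal q * B * diagonal q).IsSymm := by
  rw [IsSymm, transpose_mul, transpose_mul, diagonal_transpose, hB.eq, mul_assoc]

theorem norm_normalized_le_one {B : Matrix (Fin n) (Fin n) ℝ} (hB : B.IsSymm)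
    (h0 : ∀ i j, 0 ≤ B i j) (hd : ∀ i, 0 < degree B i) : ‖normalized B‖ ≤ 1 := by
  refine (diagonal_mul_mul_diagonal_isSymm hB _).l2_opNorm_le zero_le_one fun x => ?_
  rw [← mulVec_mulVec, ← mulVec_mulVec, dotProduct_mulVec, ← mulVec_transpose, diagonal_transpose]
  refine (hB.abs_dotProduct_mulVec_le h0 _).trans (le_of_eq ?_)
  rw [one_mul, dotProduct]
  refine Finset.sum_congr rfl fun i _ => ?_
  have := (hd i).ne'
  rw [mulVec_diagonal, mul_pow, rpow_neg_half_sq (hd i)]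
  field_simp

/-- Here `3/5 ≤ y ≤ 7/5`, so `0.77 ≤ √y ≤ 1.19`; divide `|y - 1|` by `1 + √y ≥ 1.77`. -/
theorem abs_one_sub_sqrt_le {b y : ℝ} (hb : b ≤ 2 / 5) (hy : |y - 1| ≤ b) :
    |1 - √y| ≤ b / (177 / 100) ∧ √y ≤ 119 / 100 := by
  obtain ⟨h1, h2⟩ := abs_le.1 hy
  have hlo : 77 / 100 ≤ √y := Real.le_sqrt_of_sq_le (by linarith)
  have hs : √y ^ 2 = y := Real.sq_sqrt (by linarith)
  refine ⟨?_, Real.sqrt_le_iff.2 ⟨by norm_num, by linarith⟩⟩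
  rw [le_div_iff₀ (by norm_num)]
  calc |1 - √y| * (177 / 100) ≤ |1 - √y| * |1 + √y| := by
        gcongr
        rw [abs_of_nonneg (by linarith)]
        linarith
    _ = |y - 1| := by
      rw [← abs_mul, ← abs_neg, show -((1 - √y) * (1 + √y)) = √y ^ 2 - 1 by ring, hs]
    _ ≤ b := hy

/-- Replacing the degrees by reference degrees in the normalization is a small perturbation. -/
theorem norm_normalized_sub_le {B C : Matrix (Fin n) (Fin n) ℝ} (hB : B.IsSymm)
    (h0 : ∀ i j, 0 ≤ B i j) {b : ℝ} (hb0 : 0 ≤ b) (hb : b ≤ 2 / 5) (hC : ∀ i, 0 < degree C i)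
    (hBC : ∀ i, |degree B i - degree C i| ≤ b * degree C i) :
    (∀ i, 0 < degree B i) ∧
      ‖normalized B - invSqrtDegree C * B * invSqrtDegree C‖ ≤ 5 / 4 * b := by
  have hd : ∀ i, 0 < degree B i := fun i => by
    have := (abs_le.1 (hBC i)).1
    nlinarith [hC i]
  refine ⟨hd, ?_⟩
  set σ : Fin n → ℝ := fun i => √(degree B i / degree C i) with hσ
  have hS : ∀ i, |1 - σ i| ≤ b / (177 / 100) ∧ σ i ≤ 119 / 100 := fun i => by
    refine abs_one_sub_sqrt_le hb ?_
    rw [div_sub_one (hC i).ne', abs_div, abs_of_pos (hC i), div_le_iff₀ (hC i)]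
    exact hBC i
  have e1 : diagonal σ * invSqrtDegree B = invSqrtDegree C := by
    rw [invSqrtDegree, invSqrtDegree, diagonal_mul_diagonal]
    congr 1
    ext i
    have := Real.rpow_pos_of_pos (hd i) (1 / 2)
    simp only [hσ]
    rw [Real.sqrt_eq_rpow, Real.div_rpow (hd i).le (hC i).le, Real.rpow_neg (hd i).le,
      Real.rpow_neg (hC i).le]
    field_simp
  have e2 : invSqrtDegree B * diagonal σ = invSqrtDegree C := by
    rw [← e1, invSqrtDegree, diagonal_mul_diagonal, diagonal_mul_diagonal]
    simp only [mul_comm]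
  -- With `N = normalized B` and `Σ = diagonal σ`, this is `N - Σ N Σ = (1 - Σ) N Σ + N (1 - Σ)`.
  -- The resulting constant `(1.19 + 1) / 1.77` is below `5/4`.
  have e3 : normalized B - invSqrtDegree C * B * invSqrtDegree C =
      diagonal (fun i => 1 - σ i) * normalized B * diagonal σ +
        normalized B * diagonal (fun i => 1 - σ i) := by
    have h1 : (diagonal (fun i => 1 - σ i) : Matrix (Fin n) (Fin n) ℝ) = 1 - diagonal σ := by
      rw [← diagonal_one, diagonal_sub]
    have h2 : invSqrtDegree C * B * invSqrtDegree C = diagonal σ * normalized B * diagonal σ := by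
      conv_lhs => enter [2]; rw [← e2]
      rw [← e1, normalized]
      simp only [mul_assoc]
    rw [h1, h2]
    noncomm_ring
  have n1 : ‖(diagonal (fun i => 1 - σ i) : Matrix (Fin n) (Fin n) ℝ)‖ ≤ b / (177 / 100) := by
    rw [l2_opNorm_diagonal]
    exact (pi_norm_le_iff_of_nonneg (by positivity)).2 fun i => (hS i).1
  have n2 : ‖(diagonal σ : Matrix (Fin n) (Fin n) ℝ)‖ ≤ 119 / 100 := by
    rw [l2_opNorm_diagonal]
    refine (pi_norm_le_iff_of_nonneg (by norm_num)).2 fun i => ?_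
    rw [Real.norm_of_nonneg (Real.sqrt_nonneg _)]
    exact (hS i).2
  have n3 := norm_normalized_le_one hB h0 hd
  rw [e3]
  calc _ ≤ ‖diagonal (fun i => 1 - σ i) * normalized B * diagonal σ‖ +
        ‖normalized B * diagonal (fun i => 1 - σ i)‖ := norm_add_le _ _
    _ ≤ b / (177 / 100) * 1 * (119 / 100) + 1 * (b / (177 / 100)) := by
      refine add_le_add ((norm_mul_le _ _).trans ?_) ((norm_mul_le _ _).trans ?_)
      · exact mul_le_mul ((norm_mul_le _ _).trans
          (mul_le_mul n1 n3 (norm_nonneg _) (by positivity))) n2 (norm_nonneg _) (by positivity)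
      · exact mul_le_mul n3 n1 (norm_nonneg _) zero_le_one
    _ ≤ _ := by linarith

theorem norm_normalized_sub_normalized_le {B C : Matrix (Fin n) (Fin n) ℝ} (hB : B.IsSymm)
    (hCs : C.IsSymm) (h0 : ∀ i j, 0 ≤ B i j) {b : ℝ} (hb0 : 0 ≤ b) (hb : b ≤ 2 / 5)
    (hC : ∀ i, 0 < degree C i) (hBC : ∀ i, |degree B i - degree C i| ≤ b * degree C i)
    (hq : ∀ x : Fin n → ℝ,
      |x ⬝ᵥ (invSqrtDegree C * (B - C) * invSqrtDegree C) *ᵥ x| ≤ b * (x ⬝ᵥ x)) :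
    (∀ i, 0 < degree B i) ∧ ‖normalized B - normalized C‖ ≤ 9 / 4 * b := by
  obtain ⟨hd, h1⟩ := norm_normalized_sub_le hB h0 hb0 hb hC hBC
  refine ⟨hd, ?_⟩
  have h2 : ‖invSqrtDegree C * (B - C) * invSqrtDegree C‖ ≤ b :=
    (diagonal_mul_mul_diagonal_isSymm (hB.sub hCs) _).l2_opNorm_le hb0 hq
  have e : normalized B - normalized C = (normalized B - invSqrtDegree C * B * invSqrtDegree C) +
      invSqrtDegree C * (B - C) * invSqrtDegree C := by
    rw [normalized, normalized]
    noncomm_ring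
  rw [e]
  refine (norm_add_le _ _).trans ?_
  linarith

end Deterministic

end SBM

/-! ### Choice of constants and the union bound. -/

theorem lemma2p3 {n k : ℕ} (M : SBM.Model n k) (ε : ℝ) (hε : 0 < ε)
    (hM : M.HasConcentration ε)
    {S : Type*} [MeasurableSpace S] (P : Measure S) [IsProbabilityMeasure P]
    (A : S → Matrix (Fin n) (Fin n) ℝ) (hA : M.Generates P A) :
    1 - ε ≤ P.real {s | (∀ i, 0 < SBM.degree (A s) i) ∧
      SBM.spectralNorm (SBM.normalized (A s) - SBM.normalized M.expectedAdjacency) ≤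
        3 * Real.sqrt (3 * Real.log (4 * (n : ℝ) / ε) / M.minExpectedDegree)} := by
  rcases le_or_gt 1 ε with hε1 | hε1
  · exact (sub_nonpos.2 hε1).trans measureReal_nonneg
  set δ := M.minExpectedDegree with hδ_def
  set t := Real.log (4 * (n : ℝ) / ε) with ht_def
  have hM' : 27 * t < δ := hM
  have hn : 0 < n := by
    -- For `n = 0` both the logarithm and the empty infimum take the value `0`, which contradicts
    -- the strict hypothesis.
    rcases Nat.eq_zero_or_pos n with rfl | h
    · simp [ht_def, hδ_def, SBM.Model.minExpectedDegree] at hM'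
    · exact h
  have hn1 : (1 : ℝ) ≤ n := by exact_mod_cast hn
  have ht : 0 < t := Real.log_pos (by rw [lt_div_iff₀ hε]; linarith)
  have hδ : 0 < δ := by linarith
  have hδd := M.minExpectedDegree_le
  have hd : ∀ i, 0 < SBM.degree M.expectedAdjacency i := fun i => hδ.trans_le (hδd i)
  set a := √(3 * t / δ) with ha_def
  have ha : 0 < a := Real.sqrt_pos.2 (by positivity)
  have ha2 : a ^ 2 * δ = 3 * t := by
    rw [Real.sq_sqrt (by positivity), div_mul_cancel₀ _ hδ.ne']
  have ha3 : a ≤ 1 / 3 := by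
    refine Real.sqrt_le_iff.2 ⟨by norm_num, ?_⟩
    rw [div_le_iff₀ hδ]
    linarith
  -- The factor `6/5` meets three demands: `b ≤ 2/5` given `a ≤ 1/3`, `9/4 * b ≤ 3 * a`, and `b ^ 2
  -- * δ / 4 = 27/25 * t ≥ t`, so that each tail is at most `n * exp (-t) = ε / 4`.
  set b := 6 / 5 * a with hb_def
  have hb : 0 < b := by positivity
  have hb1 : b ≤ 2 / 5 := by linarith
  have htail : n * Real.exp (-(b ^ 2 * δ / 4)) ≤ ε / 4 := by
    have h1 : -(b ^ 2 * δ / 4) ≤ -t := by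
      have : b ^ 2 * δ = 36 / 25 * (a ^ 2 * δ) := by rw [hb_def]; ring
      rw [this, ha2]
      linarith
    have h2 : Real.exp (-t) = ε / (4 * n) := by
      rw [Real.exp_neg, Real.exp_log (by positivity), inv_div]
    calc n * Real.exp (-(b ^ 2 * δ / 4)) ≤ n * Real.exp (-t) := by gcongr
      _ = ε / 4 := by rw [h2]; field_simp
  have hq : ∀ i, (SBM.degree M.expectedAdjacency i ^ (-(1 / 2 : ℝ))) ^ 2 =
      1 / SBM.degree M.expectedAdjacency i := fun i => SBM.rpow_neg_half_sq (hd i)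
  have p1 := (hA.measureReal_adjacency_gt_le hδ hδd hb (by linarith) (σ := 1) (by norm_num)
    hq).trans htail
  have p2 := (hA.measureReal_adjacency_gt_le hδ hδd hb (by linarith) (σ := -1) (by norm_num)
    hq).trans htail
  have p3 := (hA.measureReal_degree_gt_le hδ hδd hb (by linarith) (σ := 1) (by norm_num)).trans
    htail
  have p4 := (hA.measureReal_degree_gt_le hδ hδd hb (by linarith) (σ := -1) (by norm_num)).trans
    htail
  set B1 := {s | ∃ x : Fin n → ℝ, b * (x ⬝ᵥ x) < 1 * (x ⬝ᵥ
    (SBM.invSqrtDegree M.expectedAdjacency * (A s - M.expectedAdjacency) *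
      SBM.invSqrtDegree M.expectedAdjacency) *ᵥ x)} with hB1
  set B2 := {s | ∃ x : Fin n → ℝ, b * (x ⬝ᵥ x) < -1 * (x ⬝ᵥ
    (SBM.invSqrtDegree M.expectedAdjacency * (A s - M.expectedAdjacency) *
      SBM.invSqrtDegree M.expectedAdjacency) *ᵥ x)} with hB2
  set B3 := {s | ∃ i, b * SBM.degree M.expectedAdjacency i <
    1 * (SBM.degree (A s) i - SBM.degree M.expectedAdjacency i)} with hB3
  set B4 := {s | ∃ i, b * SBM.degree M.expectedAdjacency i <
    -1 * (SBM.degree (A s) i - SBM.degree M.expectedAdjacency i)} with hB4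
  set G := {s | (∀ i, 0 < SBM.degree (A s) i) ∧
    SBM.spectralNorm (SBM.normalized (A s) - SBM.normalized M.expectedAdjacency) ≤ 3 * a} with hG
  have p1' : P.real B1 ≤ ε / 4 := p1
  have p2' : P.real B2 ≤ ε / 4 := p2
  -- Covering the whole space and using subadditivity avoids any measurability of the good and bad
  -- events.
  have hcover : Set.univ ⊆ G ∪ (B1 ∪ B2 ∪ (B3 ∪ B4)) := by
    intro s _
    by_contra hs
    simp only [Set.mem_union, not_or] at hs
    obtain ⟨hsG, ⟨h1, h2⟩, h3, h4⟩ := hs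
    simp only [hB1, hB2, hB3, hB4, Set.mem_ofPred_eq, not_exists, not_lt] at h1 h2 h3 h4
    refine hsG ?_
    obtain ⟨g1, g2⟩ := SBM.norm_normalized_sub_normalized_le (hA.symm s)
      M.expectedAdjacency_isSymm
      (fun i j => by rcases hA.zero_or_one s i j with h | h <;> simp [h]) hb.le hb1 hd
      (fun i => abs_le.2 ⟨by linarith [h4 i], by linarith [h3 i]⟩)
      (fun x => abs_le.2 ⟨by linarith [h2 x], by linarith [h1 x]⟩)
    refine ⟨g1, ?_⟩
    rw [SBM.spectralNorm_eq_norm]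
    linarith
  have hu := measureReal_mono (μ := P) hcover
  have u1 := measureReal_union_le (μ := P) G (B1 ∪ B2 ∪ (B3 ∪ B4))
  have u2 := measureReal_union_le (μ := P) (B1 ∪ B2) (B3 ∪ B4)
  have u3 := measureReal_union_le (μ := P) B1 B2
  have u4 := measureReal_union_le (μ := P) B3 B4
  rw [probReal_univ] at hu
  linarith
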